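/- Let $(\Omega,\mathcal F,\mathbb P)$ be a probability space, $\mathcal G\subseteq\mathcal F$ a sub-$\sigma$-algebra and $N\ge 1$ an integer. Let $L^\infty(\mathbb R^N)$ be the space of essentially bounded $\mathcal F$-measurable random vectors $X=(X_1,\dots,X_N)^\top$, identified up to almost sure equality, and let $L^\infty_{\mathcal G}(\mathbb R^N)$ be the subspace of the $\mathcal G$-measurable ones; inequalities between random vectors are understood componentwise and almost surely. Let $r=(r_1,\dots,r_N)^\top\colon L^\infty(\mathbb R^N)\to L^\infty_{\mathcal G}(\mathbb R^N)$ be a vector-valued conditional risk measure, that is, a functional with the following three properties: - (monotonicity) $X\ge Y$ implies $r(X)\le r(Y)$, for all $X,Y\in L^\infty(\mathbb R^N)$; - (locality) $r(1_AX+1_{A^c}Y)=1_Ar(X)+1_{A^c}r(Y)$ for all $X,Y\in L^\infty(\mathbb R^N)$ and $A\in\mathcal G$; - (conditional marginal domination) for every $i\in\{1,\dots,N\}$ there is a functional $f_i\colon L^\infty_{\mathcal G}(\mathbb R)\to L^\infty_{\mathcal G}(\mathbb R)$ such that $r_i(m)\le f_i(m_i)$ for every $m\in L^\infty_{\mathcal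 G}(\mathbb R^N)$. Suppose moreover that $r$ is convex, i.e. $r(\lambda X+(1-\lambda)Y)\le\lambda r(X)+(1-\lambda)r(Y)$ for all $X,Y\in L^\infty(\mathbb R^N)$ and $\lambda\in(0,1)$, and that $r$ has the Fatou property, i.e. for every bounded sequence $(X^n)_{n\in\mathbb N}$ in $L^\infty(\mathbb R^N)$ that converges almost surely to some $X\in L^\infty(\mathbb R^N)$, one has $r_i(X)\le\liminf_{n\to\infty}r_i(X^n)$ for every $i\in\{1,\dots,N\}$. Then $r$ is conditionally separable: there exist functionals $\bar r_1,\dots,\bar r_N\colon L^\infty(\mathbb R)\to L^\infty_{\mathcal G}(\mathbb R)$ such that $r(X)=(\bar r_1(X_1),\dots,\bar r_N(X_N))^\top$ for every $X\in L^\infty(\mathbb R^N)$. -/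

import Mathlib

open MeasureTheory Filter Topology
open scoped ENNReal

noncomputable section

namespace CondRisk

variable {Ω : Type*}

/-- `L^∞(ℝ^N)`: essentially bounded random vectors, up to almost sure equality. The (in)equalities
of `Lp` are the almost sure componentwise ones. -/
abbrev LInftyVec {mF : MeasurableSpace Ω} (N : ℕ) (P : Measure Ω) := Lp (Fin N → ℝ) ∞ P

/-- `L^∞(ℝ)`. -/
abbrev LInfty {mF : MeasurableSpace Ω} (P : Measure Ω) := Lp ℝ ∞ P

/-- `L^∞_𝒢(ℝ^N)`: the elements of `L^∞(ℝ^N)` that have a `𝒢`-measurable version. -/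
abbrev LInftyVecG (N : ℕ) (mG : MeasurableSpace Ω) {mF : MeasurableSpace Ω} (P : Measure Ω) :=
  lpMeas (Fin N → ℝ) ℝ mG ∞ P

/-- `L^∞_𝒢(ℝ)`. -/
abbrev LInftyG (mG : MeasurableSpace Ω) {mF : MeasurableSpace Ω} (P : Measure Ω) := lpMeas ℝ ℝ mG ∞ P

variable {N : ℕ} {mG mF : MeasurableSpace Ω} {P : Measure Ω}

/-- The `i`-th component `X_i` of `X ∈ L^∞(ℝ^N)`. -/
def comp (i : Fin N) (X : LInftyVec N P) : LInfty P :=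
  (ContinuousLinearMap.proj (R := ℝ) (φ := fun _ : Fin N => ℝ) i).compLp X

theorem comp_coeFn (i : Fin N) (X : LInftyVec N P) : comp i X =ᵐ[P] fun ω => X ω i :=
  ContinuousLinearMap.coeFn_compLp _ X

theorem comp_mem (i : Fin N) (X : LInftyVecG N mG P) :
    comp i (X : LInftyVec N P) ∈ lpMeas ℝ ℝ mG ∞ P := by
  rw [mem_lpMeas_iff_aestronglyMeasurable]
  have h : AEStronglyMeasurable[mG] (X : LInftyVec N P) P := lpMeas.aestronglyMeasurable X
  exact ((continuous_apply i).comp_aestronglyMeasurable h).congr (comp_coeFn i _).symm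

/-- The `i`-th component of `X ∈ L^∞_𝒢(ℝ^N)`, an element of `L^∞_𝒢(ℝ)`. -/
def compG (i : Fin N) (X : LInftyVecG N mG P) : LInftyG mG P :=
  ⟨comp i (X : LInftyVec N P), comp_mem i X⟩

/-- `1_A X + 1_{Aᶜ} Y`. -/
def paste {A : Set Ω} (hA : MeasurableSet[mF] A) (X Y : LInftyVec N P) : LInftyVec N P :=
  ((Lp.memLp X).indicator hA).toLp _ + ((Lp.memLp Y).indicator hA.compl).toLp _

theorem paste_coeFn {A : Set Ω} (hA : MeasurableSet[mF] A) (X Y : LInftyVec N P) :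
    paste hA X Y =ᵐ[P] A.indicator X + Aᶜ.indicator Y :=
  (Lp.coeFn_add _ _).trans ((MemLp.coeFn_toLp _).add (MemLp.coeFn_toLp _))

/-- Monotonicity. -/
def IsMonotone (r : LInftyVec N P → LInftyVecG N mG P) : Prop :=
  ∀ X Y : LInftyVec N P, Y ≤ X → (r X : LInftyVec N P) ≤ r Y

/-- Locality. -/
def IsLocal (hG : mG ≤ mF) (r : LInftyVec N P → LInftyVecG N mG P) : Prop :=
  ∀ (X Y : LInftyVec N P) (A : Set Ω) (hA : MeasurableSet[mG] A),
    (r (paste (hG A hA) X Y) : LInftyVec N P) = paste (hG A hA) (r X) (r Y)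

/-- Conditional marginal domination property. -/
def HasCondMarginalDomination (r : LInftyVec N P → LInftyVecG N mG P) : Prop :=
  ∀ i : Fin N, ∃ f : LInftyG mG P → LInftyG mG P, ∀ m : LInftyVecG N mG P,
    (compG i (r m) : LInfty P) ≤ f (compG i m)

/-- A vector-valued conditional risk measure. -/
structure IsCondRiskMeasure (hG : mG ≤ mF) (r : LInftyVec N P → LInftyVecG N mG P) : Prop where
  monotone : IsMonotone r
  isLocal : IsLocal hG r
  domination : HasCondMarginalDomination r

/-- Convexity. -/
def IsConvex (r : LInftyVec N P → LInftyVecG N mG P) : Prop :=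
  ∀ (X Y : LInftyVec N P) (t : ℝ), 0 < t → t < 1 →
    (r (t • X + (1 - t) • Y) : LInftyVec N P) ≤
      t • (r X : LInftyVec N P) + (1 - t) • (r Y : LInftyVec N P)

/-- Fatou property; the lower limit is taken in the extended reals. -/
def HasFatou (r : LInftyVec N P → LInftyVecG N mG P) : Prop :=
  ∀ (X : ℕ → LInftyVec N P) (X' : LInftyVec N P),
    (∃ C : ℝ, ∀ n, ‖X n‖ ≤ C) →
    (∀ᵐ ω ∂P, Tendsto (fun n => X n ω) atTop (𝓝 (X' ω))) →
    ∀ i : Fin N, ∀ᵐ ω ∂P,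
      (((compG i (r X') : LInfty P) ω : ℝ) : EReal) ≤
        liminf (fun n => (((compG i (r (X n)) : LInfty P) ω : ℝ) : EReal)) atTop

/-- Conditional separability. -/
def IsCondSeparable (r : LInftyVec N P → LInftyVecG N mG P) : Prop :=
  ∃ rbar : Fin N → LInfty P → LInftyG mG P,
    ∀ (X : LInftyVec N P) (i : Fin N), compG i (r X) = rbar i (comp i X)

end CondRisk

end

open MeasureTheory Filter Topology
open scoped ENNReal

namespace CondRisk

variable {Ω : Type*} {N : ℕ} {mG mF : MeasurableSpace Ω} {P : Measure Ω}

/-! A convex function bounded above on a ray never exceeds its value at the origin of the ray. If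
`X` and `Y` share their `i`-th component, so does the whole ray `Y + s • (X - Y)`; monotonicity and
marginal domination bound `r_i` above on it uniformly in `s` (`exists_ray_bound`). Hence `r_i(X) ≤
r_i(Y)` (`comp_le_of_comp_eq`), and by symmetry equality holds: `r_i` depends on the `i`-th
component alone. -/

theorem ae_norm_le_norm {E : Type*} [NormedAddCommGroup E] (X : Lp E ∞ P) :
    ∀ᵐ ω ∂P, ‖X ω‖ ≤ ‖X‖ := by
  filter_upwards [ae_le_eLpNormEssSup (f := X) (μ := P)] with ω hω
  rw [Lp.norm_def, eLpNorm_exponent_top, ← toReal_enorm]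
  refine ENNReal.toReal_mono ?_ hω
  rw [← eLpNorm_exponent_top]
  exact Lp.eLpNorm_ne_top X

/-- The deterministic vector `c`, as an element of `L^∞_𝒢(ℝ^N)`. -/
noncomputable def constVec [IsFiniteMeasure P] (mG : MeasurableSpace Ω) (c : Fin N → ℝ) :
    LInftyVecG N mG P :=
  ⟨Lp.const ∞ P c, by
    rw [mem_lpMeas_iff_aestronglyMeasurable]
    exact aestronglyMeasurable_const.congr (Lp.coeFn_const (p := ∞) (μ := P) c).symm⟩

theorem constVec_coeFn [IsFiniteMeasure P] (mG : MeasurableSpace Ω) (c : Fin N → ℝ) :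
    ((constVec mG c : LInftyVecG N mG P) : LInftyVec N P) =ᵐ[P] fun _ => c :=
  Lp.coeFn_const (p := ∞) (μ := P) c

theorem compG_constVec_congr [IsFiniteMeasure P] (i : Fin N) {c d : Fin N → ℝ} (h : c i = d i) :
    compG i (constVec mG c : LInftyVecG N mG P) = compG i (constVec mG d) := by
  refine Subtype.ext (Lp.ext ?_)
  change comp i (constVec mG c : LInftyVecG N mG P).1 =ᵐ[P]
    comp i (constVec mG d : LInftyVecG N mG P).1
  filter_upwards [comp_coeFn i (constVec mG c : LInftyVecG N mG P).1,
    comp_coeFn i (constVec mG d : LInftyVecG N mG P).1,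
    constVec_coeFn (P := P) mG c, constVec_coeFn (P := P) mG d] with ω h₁ h₂ h₃ h₄
  rw [h₁, h₂, h₃, h₄, h]

/-- `x ∈ L^∞(ℝ)` placed in the `i`-th component, with all other components zero. -/
noncomputable def single (i : Fin N) (x : LInfty P) : LInftyVec N P :=
  (ContinuousLinearMap.single ℝ (fun _ : Fin N => ℝ) i).compLp x

theorem comp_single (i : Fin N) (x : LInfty P) : comp i (single i x) = x := by
  refine Lp.ext ?_
  filter_upwards [comp_coeFn i (single i x),
    ContinuousLinearMap.coeFn_compLp (ContinuousLinearMap.single ℝ (fun _ : Fin N => ℝ) i) x]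
    with ω h₁ h₂
  rw [h₁, single, h₂]
  simp

/-- Along the ray from `Y` in a direction `X - Y` with vanishing `i`-th component, the `i`-th
component of a monotone marginally dominated functional is bounded above uniformly. -/
theorem exists_ray_bound [IsFiniteMeasure P] {r : LInftyVec N P → LInftyVecG N mG P}
    (hmono : IsMonotone r) (hdom : HasCondMarginalDomination r) (i : Fin N)
    {X Y : LInftyVec N P} (hXY : comp i X = comp i Y) :
    ∃ C : LInfty P, ∀ s : ℝ, 0 ≤ s → ∀ᵐ ω ∂P, (r (Y + s • (X - Y)) : LInftyVec N P) ω i ≤ C ω := by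
  obtain ⟨f, hf⟩ := hdom i
  -- A deterministic lower bound for the ray. Only the components other than `i` sink as `s` grows,
  -- and the dominating `f` does not see them.
  let c : ℝ → Fin N → ℝ := fun s j => if j = i then -‖Y‖ else -‖Y‖ - s * ‖X - Y‖
  refine ⟨f (compG i (constVec mG (c 0))), fun s hs => ?_⟩
  have hle : ((constVec mG (c s) : LInftyVecG N mG P) : LInftyVec N P) ≤ Y + s • (X - Y) := by
    rw [← Lp.coeFn_le]
    have hi : comp i X =ᵐ[P] comp i Y := by rw [hXY]
    filter_upwards [constVec_coeFn (P := P) mG (c s), Lp.coeFn_add Y (s • (X - Y)),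
      Lp.coeFn_smul s (X - Y), Lp.coeFn_sub X Y, ae_norm_le_norm Y, ae_norm_le_norm (X - Y),
      hi, comp_coeFn i X, comp_coeFn i Y] with ω h₁ h₂ h₃ h₄ h₅ h₆ h₇ h₈ h₉
    rw [h₁, h₂]
    intro j
    simp only [Pi.add_apply, h₃, Pi.smul_apply, smul_eq_mul]
    have hY : -‖Y‖ ≤ Y ω j := (abs_le.mp ((norm_le_pi_norm (Y ω) j).trans h₅)).1
    by_cases hj : j = i
    · subst hj
      have hX : X ω j = Y ω j := by rw [← h₈, ← h₉, h₇]
      rw [h₄, Pi.sub_apply, Pi.sub_apply, hX, sub_self, mul_zero, add_zero]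
      simpa [c] using hY
    · have hD := (abs_le.mp ((norm_le_pi_norm ((X - Y : LInftyVec N P) ω) j).trans h₆)).1
      have := mul_le_mul_of_nonneg_left hD hs
      simp only [c, hj, if_false]
      linarith
  have hr := hmono _ _ hle
  have hb := hf (constVec mG (c s))
  rw [compG_constVec_congr i (d := c 0) (by simp [c])] at hb
  rw [← Lp.coeFn_le] at hr hb
  filter_upwards [hr, hb, comp_coeFn i (r (constVec mG (c s)).1).1] with ω h₁ h₂ h₃
  exact (h₁ i).trans (h₃ ▸ h₂)

theorem comp_le_of_comp_eq [IsFiniteMeasure P] {r : LInftyVec N P → LInftyVecG N mG P}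
    (hmono : IsMonotone r) (hdom : HasCondMarginalDomination r) (hconv : IsConvex r)
    (i : Fin N) {X Y : LInftyVec N P} (hXY : comp i X = comp i Y) :
    comp i (r X : LInftyVec N P) ≤ comp i (r Y : LInftyVec N P) := by
  obtain ⟨C, hC⟩ := exists_ray_bound hmono hdom i hXY
  -- The shift by two keeps `t n < 1` strictly, even at `n = 0`. A sequence suffices and keeps the
  -- exceptional null sets countable in number.
  let t : ℕ → ℝ := fun n => 1 / ((n : ℝ) + 1 + 1)
  have ht0 : ∀ n, 0 < t n := fun n => by positivity
  have ht1 : ∀ n, t n < 1 := fun n => by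
    rw [div_lt_one (by positivity)]
    have : (0 : ℝ) ≤ n := n.cast_nonneg
    linarith
  have htlim : Tendsto t atTop (𝓝 0) := by
    have h := (tendsto_add_atTop_iff_nat 1).mpr (tendsto_one_div_add_atTop_nhds_zero_nat (𝕜 := ℝ))
    simpa [t] using h
  have hstep : ∀ n, ∀ᵐ ω ∂P, (r X : LInftyVec N P) ω i ≤
      t n * C ω + (1 - t n) * (r Y : LInftyVec N P) ω i := fun n => by
    -- `X` lies between `Y` and the far point of the ray at parameter `1 / t n`, which carries the
    -- vanishing weight `t n`.
    have hX : t n • (Y + (t n)⁻¹ • (X - Y)) + (1 - t n) • Y = X := by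
      rw [smul_add, smul_smul, mul_inv_cancel₀ (ht0 n).ne']
      module
    have h := hconv (Y + (t n)⁻¹ • (X - Y)) Y (t n) (ht0 n) (ht1 n)
    rw [hX, ← Lp.coeFn_le] at h
    set Z : LInftyVec N P := (r (Y + (t n)⁻¹ • (X - Y))).1
    filter_upwards [h, hC (t n)⁻¹ (inv_pos.mpr (ht0 n)).le,
      Lp.coeFn_add (t n • Z) ((1 - t n) • (r Y : LInftyVec N P)),
      Lp.coeFn_smul (t n) Z, Lp.coeFn_smul (1 - t n) (r Y : LInftyVec N P)] with ω h₁ h₂ h₃ h₄ h₅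
    have h₆ := h₁ i
    simp only [h₃, Pi.add_apply, h₄, h₅, Pi.smul_apply, smul_eq_mul] at h₆
    exact h₆.trans (add_le_add_left (mul_le_mul_of_nonneg_left h₂ (ht0 n).le) _)
  rw [← Lp.coeFn_le]
  filter_upwards [ae_all_iff.mpr hstep, comp_coeFn i (r X).1, comp_coeFn i (r Y).1] with ω h h₁ h₂
  rw [h₁, h₂]
  refine ge_of_tendsto' (x := atTop) ?_ h
  simpa using (htlim.mul_const (C ω)).add
    ((tendsto_const_nhds (x := (1 : ℝ))).sub htlim |>.mul_const ((r Y : LInftyVec N P) ω i))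

end CondRisk

theorem mainTheorem3 {Ω : Type*} (mG : MeasurableSpace Ω) {mF : MeasurableSpace Ω}
    (P : Measure Ω) [IsProbabilityMeasure P] (hG : mG ≤ mF) (N : ℕ)
    (r : CondRisk.LInftyVec N P → CondRisk.LInftyVecG N mG P)
    (hr : CondRisk.IsCondRiskMeasure hG r)
    (hconv : CondRisk.IsConvex r)
    (hfatou : CondRisk.HasFatou r) :
    CondRisk.IsCondSeparable r := by
  -- Zero in the other components is an arbitrary choice, since `r_i` ignores them.
  refine ⟨fun i x => CondRisk.compG i (r (CondRisk.single i x)), fun X i => Subtype.ext ?_⟩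
  have h := CondRisk.comp_single i (CondRisk.comp i X)
  exact le_antisymm
    (CondRisk.comp_le_of_comp_eq hr.monotone hr.domination hconv i h.symm)
    (CondRisk.comp_le_of_comp_eq hr.monotone hr.domination hconv i h)
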